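/- For integers $a\ge 1$ and $k\ge 0$ let ${}^{k}a$ denote tetration, i.e. ${}^{0}a=1$ and ${}^{k+1}a=a^{({}^{k}a)}$. Consider the following two computational problems, in which all integers are given in binary. \textbf{Modular tetration problem (MTP).} Given integers $a\ge 1$, $k\ge 0$, $N\ge 1$, compute the residue ${}^{k}a \bmod N\in\{0,\dots,N-1\}$. \textbf{Discrete logarithm problem (DLP).} Given an integer $n\ge 1$ and residues $g,b\in\{0,\dots,n-1\}$ such that $\gcd(g,n)=1$ and $b$ lies in the subgroup of $(\mathbb{Z}/n\mathbb{Z})^{*}$ generated by $g$, find an integer $e\in\{0,\dots,n-1\}$ with $g^{e}\equiv b \pmod n$. \textbf{Theorem.} MTP is deterministically polynomial-time reducible to DLP. That is, there are a deterministic oracle algorithm and a polynomial $T$ such that, with any oracle that correctly answers all instances of DLP (and whatever its answers to other queries may be), the algorithm computes ${}^{k}a \bmod N$ for every instance $(a,k,N)$ of MTP in at most $T(\ell)$ bit operations, where $\ell$ is the total bit length of $a$, $k$ and $N$ and each oracle query is charged the bit length of the question and of the answer. -/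

import Mathlib

/-- Tetration: `tetration a k` is the power tower `a ^ a ^ ⋯ ^ a` of height `k`,
with value `1` at height `0`. -/
def tetration (a : ℕ) : ℕ → ℕ
  | 0 => 1
  | k + 1 => a ^ tetration a k

/-- A computational (promise search) problem whose instances are `r`-tuples of natural numbers,
written in binary, and whose solutions are natural numbers. -/
structure NumberProblem (r : ℕ) where
  /-- the admissible instances -/
  IsInstance : (Fin r → ℕ) → Prop
  /-- `IsSolution x y`: the number `y` is a correct answer to the instance `x` -/
  IsSolution : (Fin r → ℕ) → ℕ → Prop

/-- The bit length of an `r`-tuple of natural numbers. -/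
def inputLength {r : ℕ} (x : Fin r → ℕ) : ℕ := ∑ i, (x i).size

/-- An oracle for a problem: a function that answers every admissible instance correctly. Nothing
is known about its answers to inadmissible queries. -/
def NumberProblem.IsOracle {r : ℕ} (Q : NumberProblem r) (O : (Fin r → ℕ) → ℕ) : Prop :=
  ∀ x, Q.IsInstance x → Q.IsSolution x (O x)

/-- The arithmetic instructions of the machine. -/
inductive ArithOp
  | add
  | sub
  | mul
  | div

/-- The effect of an arithmetic instruction: subtraction is truncated at `0`, division is
division with remainder (and division by `0` returns `0`). -/
def ArithOp.eval : ArithOp → ℕ → ℕ → ℕ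
  | .add, m, n => m + n
  | .sub, m, n => m - n
  | .mul, m, n => m * n
  | .div, m, n => m / n

/-- Programs of a register machine with an oracle that takes `r` arguments. Registers are numbered
by natural numbers and hold natural numbers; a program mentions finitely many of them. -/
inductive OracleProgram (r : ℕ)
  /-- store the constant `c` in the register `dst` -/
  | const (dst c : ℕ)
  /-- copy the register `src` to the register `dst` -/
  | copy (dst src : ℕ)
  /-- apply an arithmetic operation to the registers `u` and `v`, store the result in `dst` -/
  | arith (op : ArithOp) (dst u v : ℕ)
  /-- ask the oracle about the contents of the registers `src`, store the answer in `dst` -/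
  | query (dst : ℕ) (src : Fin r → ℕ)
  /-- first `p`, then `q` -/
  | seq (p q : OracleProgram r)
  /-- `p` if the register `u` is nonzero, and `q` otherwise -/
  | ite (u : ℕ) (p q : OracleProgram r)
  /-- repeat `p` as long as the register `u` is nonzero -/
  | loop (u : ℕ) (p : OracleProgram r)

/-- `Exec O p s s' t`: with oracle `O`, the program `p` started with register contents `s` halts
with register contents `s'` after time `t`. Time is bit cost: every instruction and every test
is charged according to the bit lengths of the numbers that it handles, arithmetic instructions at
the cost of schoolbook multiplication, and oracle queries at the length of question and answer. -/
inductive OracleProgram.Exec {r : ℕ} (O : (Fin r → ℕ) → ℕ) :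
    OracleProgram r → (ℕ → ℕ) → (ℕ → ℕ) → ℕ → Prop
  | const (dst c : ℕ) (s : ℕ → ℕ) :
      Exec O (.const dst c) s (Function.update s dst c) (1 + c.size)
  | copy (dst src : ℕ) (s : ℕ → ℕ) :
      Exec O (.copy dst src) s (Function.update s dst (s src)) (1 + (s src).size)
  | arith (op : ArithOp) (dst u v : ℕ) (s : ℕ → ℕ) :
      Exec O (.arith op dst u v) s (Function.update s dst (op.eval (s u) (s v)))
        ((1 + (s u).size) * (1 + (s v).size))
  | query (dst : ℕ) (src : Fin r → ℕ) (s : ℕ → ℕ) :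
      Exec O (.query dst src) s (Function.update s dst (O fun i => s (src i)))
        (1 + inputLength (fun i => s (src i)) + (O fun i => s (src i)).size)
  | seq {p q : OracleProgram r} {s₁ s₂ s₃ : ℕ → ℕ} {t₁ t₂ : ℕ}
      (hp : Exec O p s₁ s₂ t₁) (hq : Exec O q s₂ s₃ t₂) :
      Exec O (.seq p q) s₁ s₃ (t₁ + t₂)
  | ite_true {u : ℕ} {p q : OracleProgram r} {s s' : ℕ → ℕ} {t : ℕ}
      (hu : s u ≠ 0) (hp : Exec O p s s' t) :
      Exec O (.ite u p q) s s' (1 + (s u).size + t)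
  | ite_false {u : ℕ} {p q : OracleProgram r} {s s' : ℕ → ℕ} {t : ℕ}
      (hu : s u = 0) (hq : Exec O q s s' t) :
      Exec O (.ite u p q) s s' (1 + t)
  | loop_done {u : ℕ} {p : OracleProgram r} {s : ℕ → ℕ} (hu : s u = 0) :
      Exec O (.loop u p) s s 1
  | loop_step {u : ℕ} {p : OracleProgram r} {s₁ s₂ s₃ : ℕ → ℕ} {t₁ t₂ : ℕ}
      (hu : s₁ u ≠ 0) (hp : Exec O p s₁ s₂ t₁) (hl : Exec O (.loop u p) s₂ s₃ t₂) :
      Exec O (.loop u p) s₁ s₃ (1 + (s₁ u).size + t₁ + t₂)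

/-- The initial register contents: the input in the registers `0, …, r - 1`, zero elsewhere. -/
def initialRegisters {r : ℕ} (x : Fin r → ℕ) : ℕ → ℕ :=
  fun i => if h : i < r then x ⟨i, h⟩ else 0

/-- Deterministic polynomial-time (Turing) reducibility: one program and one polynomial such that,
with any oracle for `Q`, the program solves every instance of `P`, leaving the answer in
register `0`, in time bounded by the polynomial in the bit length of the instance. -/
def NumberProblem.PolyTimeReducible {r r' : ℕ} (P : NumberProblem r) (Q : NumberProblem r') :
    Prop :=
  ∃ (prog : OracleProgram r') (T : Polynomial ℕ),
    ∀ O : (Fin r' → ℕ) → ℕ, Q.IsOracle O →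
      ∀ x : Fin r → ℕ, P.IsInstance x →
        ∃ (s : ℕ → ℕ) (t : ℕ), prog.Exec O (initialRegisters x) s t ∧
          P.IsSolution x (s 0) ∧ t ≤ T.eval (inputLength x)

/-- The modular tetration problem: given `(a, k, N)` with `a, N ≥ 1` and `k ≥ 0`, compute the
residue in `{0, …, N - 1}` of the tower of height `k` over `a` modulo `N`. -/
def modularTetration : NumberProblem 3 where
  IsInstance x := 1 ≤ x 0 ∧ 1 ≤ x 2
  IsSolution x y := y = tetration (x 0) (x 1) % x 2

/-- The discrete logarithm problem in the groups `(ℤ/nℤ)ˣ`: given `(n, g, b)`, where `g` and `b`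
are residues modulo `n`, `g` is invertible and `b` lies in the subgroup generated by `g`, find an
exponent `e ∈ {0, …, n - 1}` with `g ^ e ≡ b` modulo `n`. It is not required that `e` be the least
such exponent. -/
def discreteLogarithm : NumberProblem 3 where
  IsInstance x := x 1 < x 0 ∧ x 2 < x 0 ∧ (x 1).Coprime (x 0) ∧ ∃ e : ℕ, x 1 ^ e ≡ x 2 [MOD x 0]
  IsSolution x e := e < x 0 ∧ x 1 ^ e ≡ x 2 [MOD x 0]

/-! ### Running programs within a time bound -/

/-! The residue of a tower over `a` modulo `n` depends on its exponent only modulo a period of the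
powers of `a`, so towers are evaluated along a chain of moduli starting at `N`, each a period for
the one before. The usual periods require factoring; here discrete logarithms replace it. For `g`
prime to `m`, the oracle's logarithm `e < m` of `g ^ m` gives `g ^ (m - e) ≡ 1` with `0 < m - e ≤
m`.

Such a multiple of the order need not be smaller than `m`, and the chain must reach `1` after `O(log
N)` steps. If the multiple for an odd modulus `m > 1` is odd, then `a` has odd order, so `-a` has
twice that order; a multiple of the order of `-a` is then even, and its half is a period for `a` of
size at most `m / 2`. Otherwise the period is even, and an even modulus `2 ^ j * l` is halved in the
next step because `φ(2 ^ j) = 2 ^ (j - 1)`. So two steps halve the modulus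
(`shortOrderMultiple_spec`, `nextModulus_spec`, `nextModulus_iterate_eq_one`).

The part of `n` that shares primes with `a` is split off by a gcd with `a ^ B`, where `n < 2 ^ B`;
it divides `a ^ x` once `x ≥ B`. Periodicity therefore holds only for exponents from `B` on, and
exponents are tracked up to `TruncModEq`: exactly below `B`, modulo the period above
(`TruncModEq.pow`). Since the chain reaches `1` within `2 * B` steps, towers of height at least `3 *
B` all agree modulo `N`, so a large `k` can be cut down (`tetration_modEq_of_le`).

The running time is handled by a class `PolyTime` of oracle functions that is closed under
composition, guarded queries and bounded recursion. -/

theorem Polynomial.eval_nat_mono (T : Polynomial ℕ) {m n : ℕ} (h : m ≤ n) :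
    T.eval m ≤ T.eval n := by
  rw [Polynomial.eval_eq_sum_range, Polynomial.eval_eq_sum_range]
  exact Finset.sum_le_sum fun i _ => Nat.mul_le_mul_left _ (Nat.pow_le_pow_left h i)

namespace OracleProgram

variable {r : ℕ} {O : (Fin r → ℕ) → ℕ}

/-- The program `p` leads from `s` to `s'` in time at most `t`. -/
def RunsWithin (O : (Fin r → ℕ) → ℕ) (p : OracleProgram r) (s s' : ℕ → ℕ) (t : ℕ) : Prop :=
  ∃ t' ≤ t, p.Exec O s s' t'

theorem Exec.runsWithin {p : OracleProgram r} {s s' : ℕ → ℕ} {t : ℕ} (h : p.Exec O s s' t) :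
    RunsWithin O p s s' t := ⟨t, le_rfl, h⟩

theorem RunsWithin.mono {p : OracleProgram r} {s s' : ℕ → ℕ} {t t' : ℕ}
    (h : RunsWithin O p s s' t) (ht : t ≤ t') : RunsWithin O p s s' t' := by
  obtain ⟨u, hu, he⟩ := h
  exact ⟨u, hu.trans ht, he⟩

theorem RunsWithin.seq {p q : OracleProgram r} {s₁ s₂ s₃ : ℕ → ℕ} {t₁ t₂ : ℕ}
    (hp : RunsWithin O p s₁ s₂ t₁) (hq : RunsWithin O q s₂ s₃ t₂) :
    RunsWithin O (.seq p q) s₁ s₃ (t₁ + t₂) := by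
  obtain ⟨u, hu, he⟩ := hp
  obtain ⟨w, hw, hf⟩ := hq
  exact ⟨u + w, add_le_add hu hw, he.seq hf⟩

/-- A loop that is controlled by an invariant `I i s`, where `i` is the number of remaining
iterations. -/
theorem RunsWithin.loop {u : ℕ} {p : OracleProgram r} {w τ : ℕ} (I : ℕ → (ℕ → ℕ) → Prop)
    (hzero : ∀ s, I 0 s → s u = 0)
    (hsucc : ∀ i s, I (i + 1) s → s u ≠ 0 ∧ (s u).size ≤ w ∧
      ∃ s', RunsWithin O p s s' τ ∧ I i s') (i : ℕ) :
    ∀ s, I i s → ∃ s', RunsWithin O (.loop u p) s s' (i * (1 + w + τ) + 1) ∧ I 0 s' := by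
  induction i with
  | zero => exact fun s hs => ⟨s, ⟨1, by simp, .loop_done (hzero s hs)⟩, hs⟩
  | succ i ih =>
    intro s hs
    obtain ⟨hu, hw, s', ⟨t, ht, he⟩, hI⟩ := hsucc i s hs
    obtain ⟨s'', ⟨t', ht', he'⟩, hI'⟩ := ih s' hI
    refine ⟨s'', ⟨_, ?_, .loop_step hu he he'⟩, hI'⟩
    rw [add_mul]
    omega

/-- The charge for an arithmetic instruction covers the length of its result; this is what lets
running time bound the size of register contents. -/
theorem size_arithOp_eval_le (op : ArithOp) (m n : ℕ) :
    (op.eval m n).size ≤ (1 + m.size) * (1 + n.size) := by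
  have hm := Nat.lt_size_self m
  have hn := Nat.lt_size_self n
  have key : m.size + n.size + 1 ≤ (1 + m.size) * (1 + n.size) := by
    rw [add_mul, mul_add, mul_add]
    omega
  refine le_trans ?_ key
  cases op with
  | add =>
    refine Nat.size_le.2 ?_
    have h1 : 2 ^ m.size ≤ 2 ^ (m.size + n.size) := Nat.pow_le_pow_right two_pos (by omega)
    have h2 : 2 ^ n.size ≤ 2 ^ (m.size + n.size) := Nat.pow_le_pow_right two_pos (by omega)
    rw [pow_succ]
    simp only [ArithOp.eval]
    omega
  | sub => exact (Nat.size_le_size (Nat.sub_le m n)).trans (by omega)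
  | mul =>
    refine le_trans (Nat.size_le.2 ?_) (Nat.le_succ (m.size + n.size))
    rw [pow_add]
    exact Nat.mul_lt_mul'' hm hn
  | div => exact (Nat.size_le_size (Nat.div_le_self m n)).trans (by omega)

/-- The numbers that a program produces are no longer than its running time. -/
theorem Exec.size_le {p : OracleProgram r} {s s' : ℕ → ℕ} {t : ℕ} (h : p.Exec O s s' t) (i : ℕ) :
    (s' i).size ≤ max (s i).size t := by
  have aux : ∀ (s : ℕ → ℕ) (dst c t : ℕ), c.size ≤ t →
      (Function.update s dst c i).size ≤ max (s i).size t := by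
    intro s dst c t hc
    rcases eq_or_ne i dst with rfl | hi
    · simp [hc]
    · simp [Function.update_of_ne hi]
  induction h with
  | const dst c s => exact aux _ _ _ _ (by omega)
  | copy dst src s => exact aux _ _ _ _ (by omega)
  | arith op dst u v s => exact aux _ _ _ _ (size_arithOp_eval_le _ _ _)
  | query dst src s => exact aux _ _ _ _ (by omega)
  | seq _ _ h₁ h₂ => omega
  | ite_true _ _ h => omega
  | ite_false _ _ h => omega
  | loop_done => omega
  | loop_step _ _ _ h₁ h₂ => omega

end OracleProgram

open OracleProgram

/-! ### Functions that are computable in polynomial time relative to an oracle -/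

section PolyTime

variable {r : ℕ} {Q : NumberProblem r} {n : ℕ}

/-- Numerical functions of `n` arguments that may depend on an oracle for `Q`. -/
abbrev OracleFunction (Q : NumberProblem r) (n : ℕ) : Type :=
  Subtype Q.IsOracle → (Fin n → ℕ) → ℕ

/-- The values of `f` are polynomially bounded in the length of the arguments. -/
def PolyBounded (f : OracleFunction Q n) : Prop :=
  ∃ T : Polynomial ℕ, ∀ O x, f O x ≤ T.eval (inputLength x)

/-- The function `f` is computable in polynomial time. The program may be placed so that the
arguments are read from arbitrary registers `ρ i` below `b`; it leaves the value in register `b`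
and changes no register below `b`. -/
def PolyTime (f : OracleFunction Q n) : Prop :=
  ∀ (ρ : Fin n → ℕ) (b : ℕ), (∀ i, ρ i < b) →
    ∃ (p : OracleProgram r) (T : Polynomial ℕ), ∀ (O : Subtype Q.IsOracle) (s : ℕ → ℕ),
      ∃ s', RunsWithin O.1 p s s' (T.eval (inputLength (s ∘ ρ))) ∧ s' b = f O (s ∘ ρ) ∧
        ∀ j < b, s' j = s j

/-! ### Lengths and polynomial bounds -/

theorem size_le_inputLength (x : Fin n → ℕ) (i : Fin n) : (x i).size ≤ inputLength x :=
  Finset.single_le_sum (f := fun i => (x i).size) (fun _ _ => Nat.zero_le _) (Finset.mem_univ i)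

theorem inputLength_vecCons (a : ℕ) (x : Fin n → ℕ) :
    inputLength (Matrix.vecCons a x) = a.size + inputLength x := by
  simp [inputLength, Fin.sum_univ_succ]

theorem PolyBounded.mono {f g : OracleFunction Q n} (hg : PolyBounded g)
    (h : ∀ O x, f O x ≤ g O x) : PolyBounded f := by
  obtain ⟨T, hT⟩ := hg
  exact ⟨T, fun O x => (h O x).trans (hT O x)⟩

theorem PolyBounded.const (c : ℕ) : PolyBounded (Q := Q) (n := n) fun _ _ => c :=
  ⟨.C c, by simp⟩

theorem PolyBounded.add {f g : OracleFunction Q n} (hf : PolyBounded f) (hg : PolyBounded g) :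
    PolyBounded fun O x => f O x + g O x := by
  obtain ⟨T, hT⟩ := hf
  obtain ⟨U, hU⟩ := hg
  exact ⟨T + U, fun O x => by simpa using add_le_add (hT O x) (hU O x)⟩

theorem PolyBounded.mul {f g : OracleFunction Q n} (hf : PolyBounded f) (hg : PolyBounded g) :
    PolyBounded fun O x => f O x * g O x := by
  obtain ⟨T, hT⟩ := hf
  obtain ⟨U, hU⟩ := hg
  exact ⟨T * U, fun O x => by simpa using Nat.mul_le_mul (hT O x) (hU O x)⟩

/-- The output register starts at zero, so the length of its final content is at most the running
time. -/
theorem PolyTime.polyBounded_size {f : OracleFunction Q n} (hf : PolyTime f) :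
    PolyBounded fun O x => (f O x).size := by
  obtain ⟨p, T, h⟩ := hf Fin.val n fun i => i.2
  refine ⟨T, fun O x => ?_⟩
  have hx : initialRegisters x ∘ Fin.val = x := by
    funext i
    simp [initialRegisters]
  obtain ⟨s', ⟨t, ht, he⟩, hs', -⟩ := h O (initialRegisters x)
  rw [hx] at ht hs'
  have := he.size_le n
  rw [hs'] at this
  simpa [initialRegisters, ht] using this.trans (max_le (by simp [initialRegisters]) ht)

/-! ### Closure properties of polynomial time -/

theorem PolyTime.const (c : ℕ) : PolyTime (Q := Q) (n := n) fun _ _ => c := by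
  intro ρ b _
  refine ⟨.const b c, .C (1 + c.size), fun O s => ⟨_, by simpa using (Exec.const b c s).runsWithin,
    by simp, fun j hj => by simp [hj.ne]⟩⟩

theorem PolyTime.var (i : Fin n) : PolyTime (Q := Q) fun _ x => x i := by
  intro ρ b _
  refine ⟨.copy b (ρ i), 1 + .X, fun O s => ⟨_, (Exec.copy b (ρ i) s).runsWithin.mono ?_,
    by simp, fun j hj => by simp [hj.ne]⟩⟩
  simpa using size_le_inputLength (s ∘ ρ) i

/-- The values of several functions can be computed into consecutive registers. -/
theorem PolyTime.tuple {m : ℕ} {g : Fin m → OracleFunction Q n} (hg : ∀ i, PolyTime (g i))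
    (ρ : Fin n → ℕ) (b : ℕ) (hρ : ∀ i, ρ i < b) :
    ∃ (p : OracleProgram r) (T : Polynomial ℕ), ∀ (O : Subtype Q.IsOracle) (s : ℕ → ℕ),
      ∃ s', RunsWithin O.1 p s s' (T.eval (inputLength (s ∘ ρ))) ∧
        (∀ i : Fin m, s' (b + i) = g i O (s ∘ ρ)) ∧ ∀ j < b, s' j = s j := by
  induction m with
  | zero =>
    refine ⟨.const b 0, 1, fun O s => ⟨Function.update s b 0, ?_, fun i => i.elim0,
      fun j hj => by simp [hj.ne]⟩⟩
    simpa using (Exec.const b 0 s).runsWithin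
  | succ m ih =>
    obtain ⟨p, T, h⟩ := ih fun i => hg i.castSucc
    obtain ⟨q, U, h'⟩ := hg (Fin.last m) ρ (b + m) fun i => (hρ i).trans_le (Nat.le_add_right _ _)
    refine ⟨.seq p q, T + U, fun O s => ?_⟩
    obtain ⟨s₁, hr₁, hv₁, hk₁⟩ := h O s
    obtain ⟨s₂, hr₂, hv₂, hk₂⟩ := h' O s₁
    have hs : s₁ ∘ ρ = s ∘ ρ := funext fun i => hk₁ _ (hρ i)
    rw [hs] at hr₂ hv₂
    refine ⟨s₂, ?_, fun i => ?_, fun j hj => ?_⟩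
    · simpa using hr₁.seq hr₂
    · refine Fin.lastCases ?_ (fun i => ?_) i
      · simpa using hv₂
      · rw [hk₂ _ (by simp), ← hv₁ i]
        simp
    · rw [hk₂ j (by omega), hk₁ j hj]

theorem PolyTime.comp {m : ℕ} {f : OracleFunction Q m} {g : Fin m → OracleFunction Q n}
    (hf : PolyTime f) (hg : ∀ i, PolyTime (g i)) :
    PolyTime fun O x => f O fun i => g i O x := by
  intro ρ b hρ
  obtain ⟨p, T, h⟩ := PolyTime.tuple hg ρ b hρ
  obtain ⟨q, U, h'⟩ := hf (fun i => b + i) (b + m) fun i => by omega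
  choose V hV using fun i => (hg i).polyBounded_size
  obtain ⟨W, hW⟩ := hf.polyBounded_size
  refine ⟨.seq p (.seq q (.copy b (b + m))),
    T + (U.comp (∑ i, V i) + (1 + W.comp (∑ i, V i))), fun O s => ?_⟩
  obtain ⟨s₁, hr₁, hv₁, hk₁⟩ := h O s
  obtain ⟨s₂, hr₂, hv₂, hk₂⟩ := h' O s₁
  have hs : s₁ ∘ (fun i : Fin m => b + i) = fun i => g i O (s ∘ ρ) := funext hv₁
  rw [hs] at hr₂ hv₂
  have hl : inputLength (fun i => g i O (s ∘ ρ)) ≤ (∑ i, V i).eval (inputLength (s ∘ ρ)) := by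
    rw [Polynomial.eval_finsetSum]
    exact Finset.sum_le_sum fun i _ => hV i O _
  refine ⟨_, (hr₁.seq (hr₂.seq (Exec.copy b (b + m) s₂).runsWithin)).mono ?_,
    by simp [hv₂], fun j hj => ?_⟩
  · have h₁ := U.eval_nat_mono hl
    have h₂ : (f O fun i => g i O (s ∘ ρ)).size ≤ _ := (hW O _).trans (W.eval_nat_mono hl)
    rw [← hv₂] at h₂
    simp only [Polynomial.eval_add, Polynomial.eval_comp, Polynomial.eval_one]
    omega
  · rw [Function.update_of_ne hj.ne, hk₂ j (by omega), hk₁ j hj]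

theorem PolyTime.of_eq {f g : OracleFunction Q n} (hf : PolyTime f) (h : ∀ O x, f O x = g O x) :
    PolyTime g := by
  have : f = g := by
    funext O x
    exact h O x
  exact this ▸ hf

theorem PolyTime.arith (op : ArithOp) {f g : OracleFunction Q n} (hf : PolyTime f)
    (hg : PolyTime g) : PolyTime fun O x => op.eval (f O x) (g O x) := by
  have key : PolyTime (Q := Q) (n := 2) fun _ x => op.eval (x 0) (x 1) := by
    intro ρ b _
    refine ⟨.arith op b (ρ 0) (ρ 1), (1 + .X) * (1 + .X), fun O s => ⟨_,
      (Exec.arith op b (ρ 0) (ρ 1) s).runsWithin.mono ?_, by simp, fun j hj => by simp [hj.ne]⟩⟩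
    have h₀ := size_le_inputLength (s ∘ ρ) 0
    have h₁ := size_le_inputLength (s ∘ ρ) 1
    simpa using Nat.mul_le_mul (Nat.add_le_add_left h₀ 1) (Nat.add_le_add_left h₁ 1)
  exact (key.comp (g := ![f, g]) (by simp [Fin.forall_fin_two, hf, hg])).of_eq fun O x => by simp

/-- A query is admissible if it is made only for instances of the problem; answers must not be
longer than the question. -/
theorem PolyTime.query (hQ : ∀ x y, Q.IsInstance x → Q.IsSolution x y → y.size ≤ inputLength x)
    {c : OracleFunction Q n} {g : Fin r → OracleFunction Q n} (hc : PolyTime c)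
    (hg : ∀ i, PolyTime (g i)) (hi : ∀ O x, c O x ≠ 0 → Q.IsInstance fun i => g i O x) :
    PolyTime fun O x => if c O x ≠ 0 then O.1 fun i => g i O x else 0 := by
  intro ρ b hρ
  obtain ⟨p, T, h⟩ := hc ρ b hρ
  obtain ⟨q, U, h'⟩ := PolyTime.tuple hg ρ (b + 1) fun i => (hρ i).trans (Nat.lt_succ_self b)
  choose V hV using fun i => (hg i).polyBounded_size
  obtain ⟨W, hW⟩ := hc.polyBounded_size
  refine ⟨.seq p (.ite b (.seq q (.query b fun i => b + 1 + i)) (.const b 0)),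
    T + (1 + W + (U + (1 + ∑ i, V i + ∑ i, V i))), fun O s => ?_⟩
  obtain ⟨s₁, hr₁, hv₁, hk₁⟩ := h O s
  have hs : s₁ ∘ ρ = s ∘ ρ := funext fun i => hk₁ _ (hρ i)
  by_cases h0 : c O (s ∘ ρ) = 0
  · obtain ⟨t, ht, he⟩ := hr₁
    refine ⟨_, ⟨_, ?_, he.seq (.ite_false (by rw [hv₁, h0]) (.const b 0 s₁))⟩, by simp [h0],
      fun j hj => ?_⟩
    · simp only [Polynomial.eval_add, Polynomial.eval_one, Nat.size_zero]
      omega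
    · rw [Function.update_of_ne hj.ne, hk₁ j hj]
  · obtain ⟨t, ht, he⟩ := hr₁
    obtain ⟨s₂, ⟨t', ht', he'⟩, hv₂, hk₂⟩ := h' O s₁
    rw [hs] at ht' hv₂
    have hq : (fun i : Fin r => s₂ (b + 1 + i)) = fun i => g i O (s ∘ ρ) := funext hv₂
    have hI := hi O (s ∘ ρ) h0
    have hl : inputLength (fun i => g i O (s ∘ ρ)) ≤ (∑ i, V i).eval (inputLength (s ∘ ρ)) := by
      rw [Polynomial.eval_finsetSum]
      exact Finset.sum_le_sum fun i _ => hV i O _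
    have ha := hQ _ _ hI (O.2 _ hI)
    have hw : (c O (s ∘ ρ)).size ≤ _ := hW O (s ∘ ρ)
    refine ⟨_, ⟨_, ?_, he.seq (.ite_true (by rwa [hv₁])
      (he'.seq (.query b (fun i => b + 1 + i) s₂)))⟩, ?_, fun j hj => ?_⟩
    · rw [hv₁, hq]
      simp only [Polynomial.eval_add, Polynomial.eval_one]
      omega
    · simp [hq, h0]
    · rw [Function.update_of_ne hj.ne, hk₂ j (by omega), hk₁ j hj]

/-- Bounded recursion. The number of iterations is `ν c`, where `c` is a number that is
transformed by `op · k` in each round until it vanishes. -/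
theorem PolyTime.iterate (op : ArithOp) (k : ℕ) (ν : ℕ → ℕ) (hν₀ : ν 0 = 0)
    (hν : ∀ c, c ≠ 0 → ν c = ν (op.eval c k) + 1) (hop : ∀ c, op.eval c k ≤ c)
    {c f : OracleFunction Q n} {g : OracleFunction Q (n + 2)}
    {h : Subtype Q.IsOracle → (Fin n → ℕ) → ℕ → ℕ}
    (hc : PolyTime c) (hcb : PolyBounded fun O x => ν (c O x)) (hf : PolyTime f) (hg : PolyTime g)
    (h₀ : ∀ O x, h O x 0 = f O x)
    (hs : ∀ O x j, j < ν (c O x) →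
      h O x (j + 1) = g O (Matrix.vecCons j (Matrix.vecCons (h O x j) x)))
    {w : OracleFunction Q n} (hw : PolyBounded w)
    (hb : ∀ O x j, j ≤ ν (c O x) → (h O x j).size ≤ w O x) :
    PolyTime fun O x => h O x (ν (c O x)) := by
  intro ρ b hρ
  obtain ⟨p, T, hp⟩ := hf ρ b hρ
  obtain ⟨q, U, hq⟩ := hc ρ (b + 1) fun i => (hρ i).trans (Nat.lt_succ_self b)
  obtain ⟨l, V, hl⟩ := hg (Matrix.vecCons (b + 2) (Matrix.vecCons b ρ)) (b + 3) (by
    intro i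
    refine Fin.cases (by simp) (fun i => Fin.cases (by simp) (fun i => ?_) i) i
    have := hρ i
    simp only [Matrix.cons_val_succ]
    omega)
  obtain ⟨C, hC⟩ := hcb
  obtain ⟨S, hS⟩ := hc.polyBounded_size
  obtain ⟨W, hW⟩ := hw
  -- Register `b` holds the current value, `b + 1` the shrinking counter and `b + 2` the index `j`;
  -- `b + 3` receives the new value and then serves as scratch for the constants `1` and `k`.
  let body : OracleProgram r := .seq l (.seq (.copy b (b + 3)) (.seq (.const (b + 3) 1)
    (.seq (.arith .add (b + 2) (b + 2) (b + 3)) (.seq (.const (b + 3) k)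
      (.arith op (b + 1) (b + 1) (b + 3))))))
  let τ : Polynomial ℕ := V.comp (C + (W + .X)) + ((1 + W) + (2 +
    ((1 + C) * 2 + (.C (1 + k.size) + (1 + S) * .C (1 + k.size)))))
  refine ⟨.seq p (.seq q (.seq (.const (b + 2) 0) (.loop (b + 1) body))),
    T + (U + (1 + (C * (1 + S + τ) + 1))), fun O s => ?_⟩
  set x := s ∘ ρ with hx
  set N := ν (c O x) with hN
  obtain ⟨s₁, hr₁, hv₁, hk₁⟩ := hp O s
  have hs₁ : s₁ ∘ ρ = x := funext fun i => hk₁ _ (hρ i)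
  obtain ⟨s₂, hr₂, hv₂, hk₂⟩ := hq O s₁
  rw [hs₁] at hr₂ hv₂
  let s₃ := Function.update s₂ (b + 2) 0
  let I : ℕ → (ℕ → ℕ) → Prop := fun i σ => i ≤ N ∧ ν (σ (b + 1)) = i ∧ σ (b + 1) ≤ c O x ∧
    σ (b + 2) = N - i ∧ σ b = h O x (N - i) ∧ ∀ j < b, σ j = s j
  have hsize : ∀ j ≤ N, j.size ≤ C.eval (inputLength x) := fun j hj =>
    ((Nat.size_le.2 Nat.lt_two_pow_self).trans hj).trans (hC O x)
  have hI₀ : I N s₃ := by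
    refine ⟨le_rfl, ?_, ?_, ?_, ?_, fun j hj => ?_⟩
    · simp [s₃, hv₂, hN]
    · simp [s₃, hv₂]
    · simp [s₃]
    · simp only [s₃, Nat.sub_self]
      rw [Function.update_of_ne (by omega), hk₂ b (by omega), hv₁, h₀]
    · simp only [s₃]
      rw [Function.update_of_ne (by omega), hk₂ j (by omega), hk₁ j hj]
  have hzero : ∀ σ, I 0 σ → σ (b + 1) = 0 := by
    rintro σ ⟨-, h1, -⟩
    by_contra h2
    rw [hν _ h2] at h1
    omega
  have hsucc : ∀ i σ, I (i + 1) σ → σ (b + 1) ≠ 0 ∧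
      (σ (b + 1)).size ≤ S.eval (inputLength x) ∧
      ∃ σ', RunsWithin O.1 body σ σ' (τ.eval (inputLength x)) ∧ I i σ' := by
    rintro i σ ⟨hi, hνi, hle, hj, ha, hk⟩
    have hne : σ (b + 1) ≠ 0 := by
      intro h0
      rw [h0, hν₀] at hνi
      omega
    have hsz : (σ (b + 1)).size ≤ S.eval (inputLength x) :=
      (Nat.size_le_size hle).trans (hS O x)
    refine ⟨hne, hsz, ?_⟩
    obtain ⟨σ₁, hr, hv, hkeep⟩ := hl O σ
    have hσ : σ ∘ Matrix.vecCons (b + 2) (Matrix.vecCons b ρ) =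
        Matrix.vecCons (N - (i + 1)) (Matrix.vecCons (h O x (N - (i + 1))) x) := by
      funext m
      refine Fin.cases (by simp [hj]) (fun m => Fin.cases (by simp [ha]) (fun m => ?_) m) m
      simp [hx, hk _ (hρ m)]
    rw [hσ] at hr hv
    rw [← hs O x (N - (i + 1)) (by omega), show N - (i + 1) + 1 = N - i by omega] at hv
    rw [inputLength_vecCons, inputLength_vecCons] at hr
    have hlen : V.eval ((N - (i + 1)).size + ((h O x (N - (i + 1))).size + inputLength x)) ≤
        V.eval (C.eval (inputLength x) + (W.eval (inputLength x) + inputLength x)) := by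
      apply V.eval_nat_mono
      have h1 := hsize (N - (i + 1)) (by omega)
      have h2 := (hb O x (N - (i + 1)) (by omega)).trans (hW O x)
      omega
    have hk₁' := hkeep (b + 1) (by omega)
    have hk₂' := hkeep (b + 2) (by omega)
    refine ⟨_, ((hr.mono hlen).seq
      (((Exec.copy b (b + 3) σ₁).runsWithin.mono
          (t' := 1 + W.eval (inputLength x)) ?_).seq
        ((Exec.const (b + 3) 1 _).runsWithin.seq
          (((Exec.arith .add (b + 2) (b + 2) (b + 3) _).runsWithin.mono
              (t' := (1 + C.eval (inputLength x)) * 2) ?_).seq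
            ((Exec.const (b + 3) k _).runsWithin.seq
              ((Exec.arith op (b + 1) (b + 1) (b + 3) _).runsWithin.mono
                (t' := (1 + S.eval (inputLength x)) * (1 + k.size)) ?_)))))).mono ?_,
      by omega, ?_, ?_, ?_, ?_, ?_⟩
    · rw [hv]
      exact Nat.add_le_add_left ((hb O x _ (by omega)).trans (hW O x)) 1
    · simp only [Function.update_self, Nat.size_one]
      refine Nat.mul_le_mul_right _ (Nat.add_le_add_left ?_ 1)
      simpa [hk₂', hj] using hsize _ (Nat.sub_le N (i + 1))
    · simp only [Function.update_self]
      refine Nat.mul_le_mul_right _ (Nat.add_le_add_left ?_ 1)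
      simpa [hk₁'] using hsz
    · simp [τ, Polynomial.eval_comp]
    · rw [hν _ hne] at hνi
      simp [hk₁']
      omega
    · simpa [hk₁'] using (hop _).trans hle
    · simp [hk₂', hj, ArithOp.eval]
      omega
    · simp [hv]
    · intro j hjb
      rw [Function.update_of_ne (by omega), Function.update_of_ne (by omega),
        Function.update_of_ne (by omega), Function.update_of_ne (by omega),
        Function.update_of_ne (by omega), hkeep j (by omega), hk j hjb]
  obtain ⟨s₄, hr₄, -, -, -, -, hv₄, hk₄⟩ := RunsWithin.loop I hzero hsucc N s₃ hI₀
  refine ⟨s₄, (hr₁.seq (hr₂.seq ((Exec.const (b + 2) 0 s₂).runsWithin.seq hr₄))).mono ?_,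
    by simpa using hv₄, hk₄⟩
  have : N * _ ≤ _ :=
    Nat.mul_le_mul_right (1 + S.eval (inputLength x) + τ.eval (inputLength x)) (hC O x)
  rw [← hx]
  simp only [Polynomial.eval_add, Polynomial.eval_mul, Polynomial.eval_one, Nat.size_zero]
  omega

/-- A program that computes a solution of every instance gives a reduction. -/
theorem PolyTime.reducible {P : NumberProblem n} {f : OracleFunction Q n} (hf : PolyTime f)
    (h : ∀ O x, P.IsInstance x → P.IsSolution x (f O x)) : P.PolyTimeReducible Q := by
  obtain ⟨p, T, hp⟩ := hf Fin.val n fun i => i.2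
  obtain ⟨U, hU⟩ := hf.polyBounded_size
  refine ⟨.seq p (.copy 0 n), T + (1 + U), fun O hO x hx => ?_⟩
  have hρ : initialRegisters x ∘ Fin.val = x := by
    funext i
    simp [initialRegisters]
  obtain ⟨s, hr, hv, -⟩ := hp ⟨O, hO⟩ (initialRegisters x)
  rw [hρ] at hr hv
  obtain ⟨t, ht, he⟩ := hr.seq ((Exec.copy 0 n s).runsWithin)
  refine ⟨_, t, he, ?_, ht.trans ?_⟩
  · simpa [hv] using h ⟨O, hO⟩ x hx
  · have : (f ⟨O, hO⟩ x).size ≤ _ := hU ⟨O, hO⟩ x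
    simp only [hv, Polynomial.eval_add, Polynomial.eval_one]
    omega

end PolyTime

/-! ### Truncated residues -/

/-- Equality of numbers below `B`, and congruence modulo `n` from `B` on. -/
def TruncModEq (B n x y : ℕ) : Prop := x = y ∨ B ≤ x ∧ B ≤ y ∧ x ≡ y [MOD n]

theorem TruncModEq.refl (B n x : ℕ) : TruncModEq B n x x := .inl rfl

theorem TruncModEq.modEq {B n x y : ℕ} (h : TruncModEq B n x y) : x ≡ y [MOD n] := by
  rcases h with rfl | ⟨-, -, h⟩
  · exact Nat.ModEq.refl _
  · exact h

theorem TruncModEq.trans {B n x y z : ℕ} (h : TruncModEq B n x y) (h' : TruncModEq B n y z) :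
    TruncModEq B n x z := by
  rcases h with rfl | ⟨h₁, h₂, h₃⟩
  · exact h'
  · rcases h' with rfl | ⟨h₄, h₅, h₆⟩
    · exact .inr ⟨h₁, h₂, h₃⟩
    · exact .inr ⟨h₁, h₅, h₃.trans h₆⟩

/-- Multiplication by a positive number keeps both sides at least `B`; multiplication by zero may
drop them below `B`, but makes them equal. -/
theorem TruncModEq.mul_right {B n x y : ℕ} (h : TruncModEq B n x y) (z : ℕ) :
    TruncModEq B n (x * z) (y * z) := by
  rcases h with rfl | ⟨h₁, h₂, h₃⟩
  · exact .inl rfl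
  · rcases Nat.eq_zero_or_pos z with rfl | hz
    · exact .inl (by simp)
    · exact .inr ⟨h₁.trans (Nat.le_mul_of_pos_right x hz), h₂.trans (Nat.le_mul_of_pos_right y hz),
        h₃.mul_right z⟩

theorem TruncModEq.mul {B n x y z w : ℕ} (h : TruncModEq B n x y) (h' : TruncModEq B n z w) :
    TruncModEq B n (x * z) (y * w) := by
  refine (h.mul_right z).trans ?_
  rw [mul_comm y z, mul_comm y w]
  exact h'.mul_right y

/-- The canonical representative of `t` for `TruncModEq B (n + 1)`. -/
def truncMod (B n t : ℕ) : ℕ := if t < B then t else B + (t - B) % (n + 1)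

theorem truncMod_truncModEq (B n t : ℕ) : TruncModEq B (n + 1) (truncMod B n t) t := by
  unfold truncMod
  split_ifs with h
  · exact .refl _ _ _
  · refine .inr ⟨Nat.le_add_right _ _, by omega, ?_⟩
    have := (Nat.mod_modEq (t - B) (n + 1)).add_left B
    rwa [show B + (t - B) = t by omega] at this

/-- The modulus is `n + 1` and hence never zero, so the bound needs no hypothesis. -/
theorem truncMod_le (B n t : ℕ) : truncMod B n t ≤ B + n := by
  unfold truncMod
  split_ifs with h
  · omega
  · have := Nat.mod_lt (t - B) (show 0 < n + 1 by omega)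
    omega

theorem TruncModEq.truncMod_eq {B n x y : ℕ} (h : TruncModEq B (n + 1) x y) :
    truncMod B n x = truncMod B n y := by
  rcases h with rfl | ⟨h₁, h₂, h₃⟩
  · rfl
  · rw [truncMod, truncMod, if_neg (by omega), if_neg (by omega)]
    congr 1
    refine Nat.ModEq.add_left_cancel' B ?_
    rwa [show B + (x - B) = x by omega, show B + (y - B) = y by omega]

/-! ### The Euclidean algorithm -/

/-- One division step of the Euclidean algorithm. -/
def euclidStep (p : ℕ × ℕ) : ℕ × ℕ := if p.2 = 0 then p else (p.2, p.1 % p.2)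

/-- For `0 < y ≤ x` the remainder `x % y` is at most `x / 2`, so a step at least halves the product
of the two entries. -/
theorem euclidStep_iterate (k : ℕ) : ∀ x y : ℕ, y ≤ x → x * y < 2 ^ k →
    euclidStep^[k] (x, y) = (Nat.gcd x y, 0) := by
  induction k with
  | zero =>
    intro x y h h'
    have : y = 0 := by
      by_contra h0
      have := Nat.mul_pos (show 0 < x by omega) (show 0 < y by omega)
      omega
    simp [this]
  | succ k ih =>
    intro x y h h'
    rw [Function.iterate_succ_apply]
    rcases Nat.eq_zero_or_pos y with rfl | hy
    · rw [show euclidStep (x, 0) = (x, 0) by simp [euclidStep]]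
      exact ih x 0 h (by simp)
    · rw [show euclidStep (x, y) = (y, x % y) by simp [euclidStep, hy.ne'],
        ih y (x % y) (Nat.mod_lt x hy).le, Nat.gcd_comm y, ← Nat.gcd_rec, Nat.gcd_comm]
      have h1 : 2 * (x % y) ≤ x := by
        have h2 := Nat.mod_add_div x y
        have h3 : y ≤ y * (x / y) := Nat.le_mul_of_pos_right y (Nat.div_pos h hy)
        have h4 := Nat.mod_lt x hy
        omega
      rw [pow_succ] at h'
      have := Nat.mul_le_mul_left y h1
      rw [mul_comm y x, mul_left_comm] at this
      omega

theorem euclidStep_iterate_size (x y : ℕ) :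
    euclidStep^[(x * y).size + 1] (x, y) = (Nat.gcd x y, 0) := by
  have hs := Nat.lt_size_self (x * y)
  -- The one extra step puts the entries in order, as the halving argument requires.
  rw [Function.iterate_succ_apply]
  rcases Nat.eq_zero_or_pos y with rfl | hy
  · rw [show euclidStep (x, 0) = (x, 0) by simp [euclidStep]]
    exact euclidStep_iterate _ x 0 (Nat.zero_le x) hs
  · rw [show euclidStep (x, y) = (y, x % y) by simp [euclidStep, hy.ne'],
      euclidStep_iterate _ y (x % y) (Nat.mod_lt x hy).le, Nat.gcd_comm y, ← Nat.gcd_rec,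
      Nat.gcd_comm]
    rw [mul_comm x y] at hs ⊢
    exact (Nat.mul_le_mul_left y (Nat.mod_le x y)).trans_lt hs

theorem euclidStep_iterate_le (x y j : ℕ) :
    (euclidStep^[j] (x, y)).1 ≤ x + y ∧ (euclidStep^[j] (x, y)).2 ≤ x + y := by
  induction j with
  | zero => simp
  | succ j ih =>
    rw [Function.iterate_succ_apply', euclidStep]
    split_ifs
    · exact ih
    · exact ⟨ih.2, (Nat.mod_le _ _).trans ih.1⟩

theorem Nat.size_eq_size_half_succ {c : ℕ} (hc : c ≠ 0) : c.size = (c / 2).size + 1 := by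
  apply le_antisymm
  · refine Nat.size_le.2 ?_
    have := Nat.lt_size_self (c / 2)
    rw [pow_succ]
    omega
  · rw [Nat.succ_le_iff, Nat.lt_size]
    rcases hs : (c / 2).size with _ | s
    · simp; omega
    · have : 2 ^ s ≤ c / 2 := Nat.lt_size.1 (by omega)
      rw [pow_succ]
      omega

theorem Nat.size_le_self (n : ℕ) : n.size ≤ n := Nat.size_le.2 Nat.lt_two_pow_self

/-! ### Basic functions computable in polynomial time -/

section Basic

variable {r : ℕ} {Q : NumberProblem r} {n : ℕ} {f g h : OracleFunction Q n}

theorem PolyTime.add (hf : PolyTime f) (hg : PolyTime g) : PolyTime fun O x => f O x + g O x :=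
  hf.arith .add hg

theorem PolyTime.sub (hf : PolyTime f) (hg : PolyTime g) : PolyTime fun O x => f O x - g O x :=
  hf.arith .sub hg

theorem PolyTime.mul (hf : PolyTime f) (hg : PolyTime g) : PolyTime fun O x => f O x * g O x :=
  hf.arith .mul hg

theorem PolyTime.div (hf : PolyTime f) (hg : PolyTime g) : PolyTime fun O x => f O x / g O x :=
  hf.arith .div hg

theorem PolyTime.mod (hf : PolyTime f) (hg : PolyTime g) : PolyTime fun O x => f O x % g O x :=
  (hf.sub (hg.mul (hf.div hg))).of_eq fun O x => by
    have := Nat.mod_add_div (f O x) (g O x)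
    omega

theorem PolyTime.ite_eq_zero (hf : PolyTime f) (hg : PolyTime g) (hh : PolyTime h) :
    PolyTime fun O x => if f O x = 0 then g O x else h O x :=
  (((PolyTime.const 1).sub hf).mul hg).add
    (((PolyTime.const 1).sub ((PolyTime.const 1).sub hf)).mul hh) |>.of_eq fun O x => by
    split_ifs with h0
    · simp [h0]
    · simp [show 1 - f O x = 0 by omega]

theorem PolyTime.ite_lt {k : OracleFunction Q n} (hf : PolyTime f) (hg : PolyTime g)
    (hh : PolyTime h) (hk : PolyTime k) :
    PolyTime fun O x => if f O x < g O x then h O x else k O x :=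
  ((hg.sub hf).ite_eq_zero hk hh).of_eq fun O x => by
    split_ifs <;> first | rfl | omega

theorem PolyTime.min (hf : PolyTime f) (hg : PolyTime g) :
    PolyTime fun O x => Min.min (f O x) (g O x) :=
  (hf.ite_lt hg hf hg).of_eq fun O x => by
    split_ifs <;> omega

theorem PolyTime.comp₁ {F : Subtype Q.IsOracle → ℕ → ℕ}
    (hF : PolyTime (n := 1) fun O x => F O (x 0)) (hf : PolyTime f) :
    PolyTime fun O x => F O (f O x) :=
  hF.comp (g := ![f]) (by simpa using hf)

theorem PolyTime.comp₂ {F : Subtype Q.IsOracle → ℕ → ℕ → ℕ}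
    (hF : PolyTime (n := 2) fun O x => F O (x 0) (x 1)) (hf : PolyTime f) (hg : PolyTime g) :
    PolyTime fun O x => F O (f O x) (g O x) :=
  hF.comp (g := ![f, g]) (by simp [Fin.forall_fin_two, hf, hg])

theorem PolyTime.comp₄ {k : OracleFunction Q n} {F : Subtype Q.IsOracle → ℕ → ℕ → ℕ → ℕ → ℕ}
    (hF : PolyTime (n := 4) fun O x => F O (x 0) (x 1) (x 2) (x 3)) (hf : PolyTime f)
    (hg : PolyTime g) (hh : PolyTime h) (hk : PolyTime k) :
    PolyTime fun O x => F O (f O x) (g O x) (h O x) (k O x) :=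
  hF.comp (g := ![f, g, h, k]) (by
    intro i
    fin_cases i
    exacts [hf, hg, hh, hk])

theorem PolyTime.size (hf : PolyTime f) : PolyTime fun O x => (f O x).size := by
  have hb : PolyBounded (Q := Q) (n := 1) fun _ x => (x 0).size := (PolyTime.var 0).polyBounded_size
  refine PolyTime.comp₁ (F := fun _ y => y.size) ?_ hf
  exact PolyTime.iterate .div 2 Nat.size Nat.size_zero (fun c hc => Nat.size_eq_size_half_succ hc)
    (fun c => Nat.div_le_self c 2) (h := fun _ _ j => j) (PolyTime.var 0) hb (PolyTime.const 0)
    ((PolyTime.var 0).add (PolyTime.const 1)) (fun _ _ => rfl) (fun _ _ _ _ => rfl)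
    hb fun O x j hj => (Nat.size_le_self j).trans hj

/-- Recursion with a polynomially bounded number of steps and values of polynomial length. -/
theorem PolyTime.natRec {c f : OracleFunction Q n} {g : OracleFunction Q (n + 2)}
    {h : Subtype Q.IsOracle → (Fin n → ℕ) → ℕ → ℕ} (hc : PolyTime c) (hcb : PolyBounded c)
    (hf : PolyTime f) (hg : PolyTime g) (h₀ : ∀ O x, h O x 0 = f O x)
    (hs : ∀ O x j, j < c O x →
      h O x (j + 1) = g O (Matrix.vecCons j (Matrix.vecCons (h O x j) x)))
    {w : OracleFunction Q n} (hw : PolyBounded w)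
    (hb : ∀ O x j, j ≤ c O x → (h O x j).size ≤ w O x) :
    PolyTime fun O x => h O x (c O x) :=
  PolyTime.iterate .sub 1 id rfl (fun c hc => by simp [ArithOp.eval]; omega)
    (fun c => Nat.sub_le c 1) hc hcb hf hg h₀ hs hw hb

theorem PolyTime.div_two_pow (hf : PolyTime f) (hg : PolyTime g) (hb : PolyBounded g) :
    PolyTime fun O x => f O x / 2 ^ g O x := by
  exact PolyTime.natRec (h := fun O x j => f O x / 2 ^ j) hg hb hf
    ((PolyTime.var 1).div (PolyTime.const 2)) (fun O x => by simp)
    (fun O x j _ => by simp [pow_succ, Nat.div_div_eq_div_mul]) hf.polyBounded_size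
    (fun O x j _ => Nat.size_le_size (Nat.div_le_self _ _))

theorem PolyTime.gcd (hf : PolyTime f) (hg : PolyTime g) :
    PolyTime fun O x => Nat.gcd (f O x) (g O x) := by
  refine PolyTime.comp₂ (F := fun _ y z => Nat.gcd y z) ?_ hf hg
  have v₀ : PolyTime (Q := Q) (n := 2) fun _ x => x 0 := PolyTime.var 0
  have v₁ : PolyTime (Q := Q) (n := 2) fun _ x => x 1 := PolyTime.var 1
  have hW : PolyTime (Q := Q) (n := 2) fun _ x => x 0 + x 1 + 1 := (v₀.add v₁).add (.const 1)
  have hW' : PolyTime (Q := Q) (n := 4) fun _ x => x 2 + x 3 + 1 :=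
    ((PolyTime.var 2).add (PolyTime.var 3)).add (.const 1)
  have hX := (PolyTime.var (Q := Q) (n := 4) 1).div hW'
  have hY := (PolyTime.var (Q := Q) (n := 4) 1).mod hW'
  have hcount : PolyTime (Q := Q) (n := 2) fun _ x => (x 0 * x 1).size + 1 :=
    (v₀.mul v₁).size.add (.const 1)
  -- The recursion carries a single number, so the pair `p` is encoded as `p.1 * W + p.2` with `W =
  -- x 0 + x 1 + 1`, which exceeds both entries throughout.
  have key := PolyTime.natRec
    (h := fun _ x j => (euclidStep^[j] (x 0, x 1)).1 * (x 0 + x 1 + 1) +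
      (euclidStep^[j] (x 0, x 1)).2)
    hcount ((v₀.mul v₁).polyBounded_size.add (.const 1)) ((v₀.mul hW).add v₁)
    (hY.ite_eq_zero (PolyTime.var 1) ((hY.mul hW').add (hX.mod hY))) (fun O x => by simp)
    (fun O x j _ => by
      obtain ⟨h₁, h₂⟩ := euclidStep_iterate_le (x 0) (x 1) j
      have hp : 0 < x 0 + x 1 + 1 := Nat.succ_pos _
      change _ = if ((euclidStep^[j] (x 0, x 1)).1 * (x 0 + x 1 + 1) +
          (euclidStep^[j] (x 0, x 1)).2) % (x 0 + x 1 + 1) = 0 then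
        (euclidStep^[j] (x 0, x 1)).1 * (x 0 + x 1 + 1) + (euclidStep^[j] (x 0, x 1)).2 else
        ((euclidStep^[j] (x 0, x 1)).1 * (x 0 + x 1 + 1) +
          (euclidStep^[j] (x 0, x 1)).2) % (x 0 + x 1 + 1) * (x 0 + x 1 + 1) +
        ((euclidStep^[j] (x 0, x 1)).1 * (x 0 + x 1 + 1) +
          (euclidStep^[j] (x 0, x 1)).2) / (x 0 + x 1 + 1) %
        (((euclidStep^[j] (x 0, x 1)).1 * (x 0 + x 1 + 1) +
          (euclidStep^[j] (x 0, x 1)).2) % (x 0 + x 1 + 1))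
      rw [Function.iterate_succ_apply']
      generalize euclidStep^[j] (x 0, x 1) = p at h₁ h₂ ⊢
      have hmod : (p.1 * (x 0 + x 1 + 1) + p.2) % (x 0 + x 1 + 1) = p.2 := by
        rw [mul_comm, Nat.mul_add_mod, Nat.mod_eq_of_lt (by omega)]
      have hdiv : (p.1 * (x 0 + x 1 + 1) + p.2) / (x 0 + x 1 + 1) = p.1 := by
        rw [mul_comm, Nat.mul_add_div hp, Nat.div_eq_of_lt (by omega), add_zero]
      rw [hmod, hdiv, euclidStep]
      split_ifs <;> rfl)
    (((v₀.add v₁).mul hW).add (v₀.add v₁)).polyBounded_size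
    (fun O x j _ => by
      obtain ⟨h₁, h₂⟩ := euclidStep_iterate_le (x 0) (x 1) j
      exact Nat.size_le_size (add_le_add (Nat.mul_le_mul_right _ h₁) h₂))
  refine (key.div hW).of_eq fun O x => ?_
  simp only [euclidStep_iterate_size, add_zero]
  exact Nat.mul_div_cancel _ (Nat.succ_pos _)

theorem PolyTime.truncMod (hf : PolyTime f) (hg : PolyTime g) (hh : PolyTime h) :
    PolyTime fun O x => truncMod (f O x) (g O x) (h O x) :=
  hh.ite_lt hf hh (hf.add ((hh.sub hf).mod (hg.add (.const 1))))

theorem PolyTime.truncMod_pow {k : OracleFunction Q n} (hf : PolyTime f) (hg : PolyTime g)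
    (hh : PolyTime h) (hk : PolyTime k) :
    PolyTime fun O x => _root_.truncMod (f O x) (g O x) (h O x ^ k O x) := by
  refine PolyTime.comp₄ (F := fun _ B n a e => _root_.truncMod B n (a ^ e)) ?_ hf hg hh hk
  have w : ∀ i : Fin 6, PolyTime (Q := Q) (n := 6) fun _ x => x i := PolyTime.var
  have v : ∀ i : Fin 4, PolyTime (Q := Q) (n := 4) fun _ x => x i := PolyTime.var
  have hu : PolyTime (Q := Q) (n := 6) fun _ x => x 5 / 2 ^ ((x 5).size - 1 - x 0) :=
    (w 5).div_two_pow (((w 5).size.sub (.const 1)).sub (w 0))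
      ((w 5).polyBounded_size.mono fun O x => by omega)
  -- Square and multiply from the top bit: after `j` rounds the exponent consists of the leading `j`
  -- bits of `x 3`.
  have key := PolyTime.natRec
    (h := fun _ x j => _root_.truncMod (x 0) (x 1) (x 2 ^ (x 3 / 2 ^ ((x 3).size - j))))
    (v 3).size (v 3).polyBounded_size ((v 0).truncMod (v 1) (.const 1))
    ((w 2).truncMod (w 3) (((w 1).mul (w 1)).mul
      ((hu.mod (.const 2)).ite_eq_zero (.const 1) (w 4))))
    (fun O x => by simp [Nat.div_eq_of_lt (Nat.lt_size_self (x 3))])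
    (fun O x j hj => by
      change _ = _root_.truncMod (x 0) (x 1)
        (_root_.truncMod (x 0) (x 1) (x 2 ^ (x 3 / 2 ^ ((x 3).size - j))) *
          _root_.truncMod (x 0) (x 1) (x 2 ^ (x 3 / 2 ^ ((x 3).size - j))) *
          if (x 3 / 2 ^ ((x 3).size - 1 - j)) % 2 = 0 then 1 else x 2)
      rw [show (x 3).size - j = (x 3).size - 1 - j + 1 by omega,
        show (x 3).size - (j + 1) = (x 3).size - 1 - j by omega, pow_succ 2,
        ← Nat.div_div_eq_div_mul]
      generalize x 3 / 2 ^ ((x 3).size - 1 - j) = u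
      have hT := truncMod_truncModEq (x 0) (x 1) (x 2 ^ (u / 2))
      rw [((hT.mul hT).mul_right _).truncMod_eq]
      congr 1
      rcases Nat.mod_two_eq_zero_or_one u with h0 | h1
      · rw [if_pos h0, mul_one, ← pow_add]
        congr 1
        omega
      · rw [if_neg (by omega), ← pow_add, ← pow_succ]
        congr 1
        omega)
    ((v 0).add (v 1)).polyBounded_size
    (fun O x j _ => Nat.size_le_size (truncMod_le _ _ _))
  exact key.of_eq fun O x => by simp

end Basic

/-! ### Periods of powers from discrete logarithms -/

/-- A multiple of the order of `g` modulo `m`, if `g` is prime to `m`: the difference between `m`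
and a discrete logarithm of `g ^ m`. -/
def orderMultiple (O : Subtype discreteLogarithm.IsOracle) (m g : ℕ) : ℕ :=
  m - if (if Nat.gcd g m - 1 = 0 then m else 0) ≠ 0 then O.1 ![m, g % m, g ^ m % m] else 0

theorem isInstance_discreteLogarithm {m g : ℕ} (hm : 0 < m) (hg : g.Coprime m) :
    discreteLogarithm.IsInstance ![m, g % m, g ^ m % m] := by
  refine ⟨Nat.mod_lt _ hm, Nat.mod_lt _ hm, ?_, m, ?_⟩
  · change Nat.gcd (g % m) m = 1
    rwa [← Nat.gcd_rec, Nat.gcd_comm]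
  · change (g % m) ^ m ≡ g ^ m % m [MOD m]
    exact ((Nat.mod_modEq g m).pow m).trans (Nat.mod_modEq _ _).symm

theorem orderMultiple_spec (O : Subtype discreteLogarithm.IsOracle) {m g : ℕ} (hm : 0 < m)
    (hg : g.Coprime m) :
    0 < orderMultiple O m g ∧ orderMultiple O m g ≤ m ∧ g ^ orderMultiple O m g ≡ 1 [MOD m] := by
  have hc : (if Nat.gcd g m - 1 = 0 then m else 0) ≠ 0 := by
    rw [hg]
    simpa using hm.ne'
  rw [orderMultiple, if_pos hc]
  have h := O.2 _ (isInstance_discreteLogarithm hm hg)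
  generalize O.1 ![m, g % m, g ^ m % m] = e at h
  obtain ⟨hlt, he⟩ := h
  change e < m at hlt
  change (g % m) ^ e ≡ g ^ m % m [MOD m] at he
  refine ⟨by omega, by omega, ?_⟩
  have h1 : g ^ e ≡ g ^ m [MOD m] :=
    ((Nat.mod_modEq g m).pow e).symm.trans (he.trans (Nat.mod_modEq _ _))
  refine Nat.ModEq.cancel_left_of_coprime (c := g ^ e) (hg.pow_left e).symm ?_
  rw [← pow_add, show e + (m - e) = m by omega, mul_one]
  exact h1.symm

/-- A multiple of the order of `a` modulo `m` for odd `m` prime to `a` that is even or at most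
`m / 2` if `m ≠ 1`. -/
def shortOrderMultiple (O : Subtype discreteLogarithm.IsOracle) (m a : ℕ) : ℕ :=
  if orderMultiple O m a % 2 = 0 then orderMultiple O m a
  else (orderMultiple O m ((m - 1) * a) + 1) / 2

/-- If `a` has odd order modulo `m`, then `-a` has twice that order. -/
theorem pow_half_eq_one_of_neg_pow_eq_one {R : Type*} [CommRing R] (hR : (-1 : R) ≠ 1) {a : R}
    {s t : ℕ} (hs : Odd s) (h : a ^ s = 1) (h' : (-a) ^ t = 1) : Even t ∧ a ^ (t / 2) = 1 := by
  have ht : Even t := by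
    by_contra ho
    rw [Nat.not_even_iff_odd] at ho
    apply hR
    have : (-a) ^ (t * s) = 1 := by rw [pow_mul, h', one_pow]
    rwa [(ho.mul hs).neg_pow, mul_comm, pow_mul, h, one_pow] at this
  refine ⟨ht, ?_⟩
  rw [ht.neg_pow] at h'
  obtain ⟨u, rfl⟩ := hs
  obtain ⟨v, rfl⟩ := ht
  rw [show (v + v) / 2 = v by omega]
  -- The element `a ^ v` is killed by the exponent `2` and by an odd exponent, hence is `1`.
  have h1 : (a ^ v) ^ (2 * u + 1) = 1 := by rw [← pow_mul, mul_comm, pow_mul, h, one_pow]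
  rw [pow_succ, pow_mul, ← pow_mul a v 2, mul_two, h', one_pow, one_mul] at h1
  exact h1

/-- An odd multiple of the order shows that `a` has odd order, and then the multiple found for `-a`,
represented by `(m - 1) * a`, is even and can be halved. This needs `-1 ≠ 1`, hence `m > 2`. -/
theorem shortOrderMultiple_spec (O : Subtype discreteLogarithm.IsOracle) {m a : ℕ} (hm : Odd m)
    (ha : a.Coprime m) :
    0 < shortOrderMultiple O m a ∧ shortOrderMultiple O m a ≤ m ∧
      a ^ shortOrderMultiple O m a ≡ 1 [MOD m] ∧
      (m = 1 ∨ Even (shortOrderMultiple O m a) ∨ 2 * shortOrderMultiple O m a ≤ m) := by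
  have hm0 : 0 < m := hm.pos
  obtain ⟨h₁, h₂, h₃⟩ := orderMultiple_spec O hm0 ha
  have hcop : ((m - 1) * a).Coprime m := by
    refine Nat.Coprime.mul_left ?_ ha
    have := Nat.coprime_self_sub_left (m := 1) (n := m) hm0
    simpa using this
  obtain ⟨h₄, h₅, h₆⟩ := orderMultiple_spec O hm0 hcop
  rw [shortOrderMultiple]
  split_ifs with h
  · exact ⟨h₁, h₂, h₃, .inr (.inl (Nat.even_iff.2 h))⟩
  · rcases eq_or_ne m 1 with rfl | hm1
    · have : orderMultiple O 1 ((1 - 1) * a) = 1 := by omega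
      exact ⟨by omega, by omega, Nat.modEq_one, .inl rfl⟩
    · have : Fact (2 < m) := ⟨by
        obtain ⟨u, rfl⟩ := hm
        omega⟩
      have e₁ : (a : ZMod m) ^ orderMultiple O m a = 1 := by
        exact_mod_cast (ZMod.natCast_eq_natCast_iff _ _ _).2 h₃
      have e₂ : (-a : ZMod m) ^ orderMultiple O m ((m - 1) * a) = 1 := by
        have := (ZMod.natCast_eq_natCast_iff _ _ _).2 h₆
        rw [Nat.cast_pow, Nat.cast_mul, Nat.cast_sub hm0] at this
        simpa using this
      obtain ⟨h₇, h₈⟩ := pow_half_eq_one_of_neg_pow_eq_one ZMod.neg_one_ne_one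
        (Nat.odd_iff.2 (by omega)) e₁ e₂
      have h₉ := Nat.even_iff.1 h₇
      have h₁₀ : (orderMultiple O m ((m - 1) * a) + 1) / 2 =
        orderMultiple O m ((m - 1) * a) / 2 := by omega
      rw [h₁₀]
      refine ⟨by omega, by omega, ?_, .inr (.inr (by omega))⟩
      refine (ZMod.natCast_eq_natCast_iff _ _ _).1 ?_
      exact_mod_cast h₈

/-! ### Splitting a modulus without factoring, and the chain of moduli -/

/-- The greatest common divisor of `c ^ B` and `n`, if `n` is positive. -/
def powGcd (c B n : ℕ) : ℕ := Nat.gcd (truncMod 0 (n - 1) (c ^ B)) n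

theorem truncMod_zero_pred {n : ℕ} (hn : 0 < n) (t : ℕ) : truncMod 0 (n - 1) t = t % n := by
  simp [truncMod, Nat.sub_add_cancel hn]

/-- If `B` is large, then `powGcd c B n` splits off from `n` all primes that divide `c`. -/
theorem powGcd_spec {c B n : ℕ} (hn : 0 < n) (hB : n < 2 ^ B) :
    powGcd c B n * (n / powGcd c B n) = n ∧ powGcd c B n ∣ c ^ B ∧
      c.Coprime (n / powGcd c B n) := by
  have hd : powGcd c B n = Nat.gcd (c ^ B) n := by
    rw [powGcd, truncMod_zero_pred hn, ← Nat.gcd_rec, Nat.gcd_comm]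
  rw [hd]
  have hdn := Nat.gcd_dvd_right (c ^ B) n
  refine ⟨Nat.mul_div_cancel' hdn, Nat.gcd_dvd_left _ _, ?_⟩
  rcases Nat.eq_zero_or_pos c with rfl | hc
  · have hB0 : B ≠ 0 := by
      rintro rfl
      simp at hB
      omega
    simp [zero_pow hB0, Nat.div_self hn]
  refine Nat.Coprime.symm (Nat.coprime_of_dvd fun p hp h₁ h₂ => ?_)
  have h₃ : p * Nat.gcd (c ^ B) n ∣ n := by
    rw [mul_comm]
    exact (Nat.dvd_div_iff_mul_dvd hdn).1 h₁
  have hg : Nat.gcd (c ^ B) n ≠ 0 := (Nat.gcd_pos_of_pos_right _ hn).ne'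
  -- A common prime `p` of `c` and the cofactor would force the `p`-adic valuation of `n` to exceed
  -- that of the gcd. But `B` is larger than the valuation of `n`, so the gcd already contains the
  -- full power of `p`.
  have h₄ := (Nat.factorization_le_iff_dvd (mul_ne_zero hp.ne_zero hg) hn.ne').2 h₃ p
  rw [Nat.factorization_mul hp.ne_zero hg, Nat.factorization_gcd (pow_pos hc B).ne' hn.ne'] at h₄
  simp only [Finsupp.coe_add, Pi.add_apply, Finsupp.inf_apply, hp.factorization_self,
    Nat.factorization_pow, Finsupp.smul_apply, smul_eq_mul] at h₄
  have h₅ : 1 ≤ c.factorization p := (hp.dvd_iff_one_le_factorization hc.ne').1 h₂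
  have h₆ : n.factorization p < B := by
    refine (Nat.pow_lt_pow_iff_right (a := 2) one_lt_two).1 (lt_of_le_of_lt ?_ hB)
    exact (Nat.pow_le_pow_left hp.two_le _).trans (Nat.ordProj_le p hn.ne')
  have h₇ : B ≤ B * c.factorization p := Nat.le_mul_of_pos_right B h₅
  rw [min_eq_right (by omega)] at h₄
  omega

/-- A period modulo `n` of the powers of `a` with exponents from `B` on. -/
def nextModulus (O : Subtype discreteLogarithm.IsOracle) (a B n : ℕ) : ℕ :=
  min n ((powGcd 2 B n + 1) / 2 * shortOrderMultiple O
    (n / powGcd 2 B n / powGcd a B (n / powGcd 2 B n)) a)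

theorem pow_add_modEq_of_dvd {a d B x M : ℕ} (h : d ∣ a ^ B) (hx : B ≤ x) :
    a ^ (x + M) ≡ a ^ x [MOD d] := by
  have h' : d ∣ a ^ x := h.trans (pow_dvd_pow a hx)
  exact ((Nat.modEq_zero_iff_dvd.2 (h'.trans (pow_dvd_pow a (Nat.le_add_right x M)))).trans
    (Nat.modEq_zero_iff_dvd.2 h').symm)

theorem pow_add_modEq_of_pow_modEq_one {a d e M : ℕ} (h : a ^ e ≡ 1 [MOD d]) (he : e ∣ M) (x : ℕ) :
    a ^ (x + M) ≡ a ^ x [MOD d] := by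
  obtain ⟨q, rfl⟩ := he
  simpa [pow_add, pow_mul] using (h.pow q).mul_left (a ^ x)

/-- Write `n = d * q * m` with pairwise coprime factors: `d` a power of two, `q` odd and composed of
primes of `a`, and `m` odd and prime to `a`. Modulo `q` the powers vanish from `B` on, modulo `m`
they have period `M`, and modulo `d` they either vanish (even `a`) or have period `φ(d)`. The even
case loses a factor `2` because `φ(2 ^ (j + 1)) = 2 ^ j`. -/
theorem nextModulus_spec (O : Subtype discreteLogarithm.IsOracle) {a B n : ℕ} (hn : 0 < n)
    (hB : n < 2 ^ B) :
    0 < nextModulus O a B n ∧ (Even n → 2 * nextModulus O a B n ≤ n) ∧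
      (n = 1 ∨ Even (nextModulus O a B n) ∨ 2 * nextModulus O a B n ≤ n) ∧
      ∀ x, B ≤ x → a ^ (x + nextModulus O a B n) ≡ a ^ x [MOD n] := by
  rw [nextModulus]
  obtain ⟨h₁, h₂, h₃⟩ := powGcd_spec (c := 2) hn hB
  generalize powGcd 2 B n = d at *
  generalize n / d = l at *
  have hl0 : 0 < l := Nat.pos_of_ne_zero fun h => by simp [h] at h₁; omega
  have hln : l ≤ n := Nat.le_of_dvd hn ⟨d, by rw [mul_comm, h₁]⟩
  obtain ⟨h₄, h₅, h₆⟩ := powGcd_spec (c := a) hl0 (hln.trans_lt hB)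
  generalize powGcd a B l = q at *
  generalize l / q = m at *
  have hl : Odd l := Nat.coprime_two_left.1 h₃
  have hm : Odd m := (Nat.odd_mul.1 (h₄ ▸ hl)).2
  have hq0 : 0 < q := Nat.pos_of_ne_zero fun h => by simp [h] at h₄; omega
  have hml : m ≤ l := h₄ ▸ Nat.le_mul_of_pos_left m hq0
  obtain ⟨h₇, h₈, h₉, h₁₀⟩ := shortOrderMultiple_spec O hm h₆
  generalize shortOrderMultiple O m a = M at *
  have hperiod : ∀ e, e ∣ (d + 1) / 2 * M → a ^ e ≡ 1 [MOD d] ∨ d ∣ a ^ B →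
      ∀ x, B ≤ x → a ^ (x + (d + 1) / 2 * M) ≡ a ^ x [MOD n] := by
    intro e he hd x hx
    have hqm : a ^ (x + (d + 1) / 2 * M) ≡ a ^ x [MOD l] := by
      rw [← h₄]
      refine (Nat.modEq_and_modEq_iff_modEq_mul ?_).1
        ⟨pow_add_modEq_of_dvd h₅ hx, pow_add_modEq_of_pow_modEq_one h₉ (Nat.dvd_mul_left _ _) x⟩
      exact (h₆.pow_left B).coprime_dvd_left h₅
    rw [← h₁]
    refine (Nat.modEq_and_modEq_iff_modEq_mul ?_).1 ⟨?_, hqm⟩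
    · exact (h₃.pow_left B).coprime_dvd_left h₂
    · rcases hd with hd | hd
      · exact pow_add_modEq_of_pow_modEq_one hd he x
      · exact pow_add_modEq_of_dvd hd hx
  obtain ⟨j, hj, rfl⟩ := (Nat.dvd_prime_pow Nat.prime_two).1 h₂
  -- The rounded half `(d + 1) / 2` equals `φ(d)` in both cases: `1` for `d = 1` and `2 ^ j` for `d
  -- = 2 ^ (j + 1)`.
  rcases j with _ | j
  · have hM : (2 ^ 0 + 1) / 2 * M = M := by simp
    rw [hM] at hperiod ⊢
    rw [pow_zero, one_mul] at h₁
    rw [min_eq_right (by omega)]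
    refine ⟨h₇, fun he => ?_, ?_, hperiod 1 (one_dvd _) (.inl Nat.modEq_one)⟩
    · rw [← h₁] at he
      exact absurd he (Nat.not_even_iff_odd.2 hl)
    · rcases h₁₀ with h | h | h
      · omega
      · exact .inr (.inl h)
      · exact .inr (.inr (by omega))
  · have hd : (2 ^ (j + 1) + 1) / 2 = 2 ^ j := by
      rw [pow_succ]
      omega
    rw [hd] at hperiod ⊢
    have hle : 2 * (2 ^ j * M) ≤ n := by
      rw [← mul_assoc, ← pow_succ', ← h₁]
      exact Nat.mul_le_mul_left _ (h₈.trans hml)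
    rw [min_eq_right (by omega)]
    refine ⟨Nat.mul_pos (by positivity) h₇, fun _ => hle, .inr (.inr hle),
      hperiod (2 ^ j) (Nat.dvd_mul_right _ _) ?_⟩
    rcases Nat.even_or_odd a with ha | ha
    · exact .inr ((pow_dvd_pow 2 hj).trans (pow_dvd_pow_of_dvd ha.two_dvd B))
    · have := Nat.ModEq.pow_totient ((Nat.coprime_two_right.2 ha).pow_right (j + 1))
      rw [Nat.totient_prime_pow_succ Nat.prime_two] at this
      exact .inl (by simpa using this)

/-- The minimum in the definition makes this hold for all inputs, including those that are not
instances, where `PolyTime` still demands bounds; for `0 < n < 2 ^ B` it changes nothing. -/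
theorem nextModulus_le (O : Subtype discreteLogarithm.IsOracle) (a B n : ℕ) :
    nextModulus O a B n ≤ n := min_le_left _ _

theorem iterate_le_of_le {f : ℕ → ℕ} (hf : ∀ n, f n ≤ n) (i n : ℕ) : f^[i] n ≤ n := by
  induction i with
  | zero => exact le_rfl
  | succ i ih =>
    rw [Function.iterate_succ_apply']
    exact (hf _).trans ih

theorem nextModulus_iterate_pos (O : Subtype discreteLogarithm.IsOracle) {a B n : ℕ} (hn : 0 < n)
    (hB : n < 2 ^ B) (i : ℕ) : 0 < (nextModulus O a B)^[i] n := by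
  induction i with
  | zero => exact hn
  | succ i ih =>
    rw [Function.iterate_succ_apply']
    exact (nextModulus_spec O ih
      ((iterate_le_of_le (nextModulus_le O a B) i n).trans_lt hB)).1

/-- Two steps halve the modulus, so that it soon becomes `1`. -/
theorem nextModulus_iterate_eq_one (O : Subtype discreteLogarithm.IsOracle) {a B n : ℕ}
    (hn : 0 < n) (hB : n < 2 ^ B) : (nextModulus O a B)^[2 * B] n = 1 := by
  have key : ∀ i, (nextModulus O a B)^[2 * i] n = 1 ∨
      2 ^ i * (nextModulus O a B)^[2 * i] n ≤ n := by
    intro i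
    induction i with
    | zero => simp
    | succ i ih =>
      rw [show 2 * (i + 1) = 2 * i + 1 + 1 by ring, Function.iterate_succ_apply',
        Function.iterate_succ_apply']
      have hm := nextModulus_iterate_pos O (a := a) hn hB (2 * i)
      have hmB := (iterate_le_of_le (nextModulus_le O a B) (2 * i) n).trans_lt hB
      generalize (nextModulus O a B)^[2 * i] n = m at ih hm hmB
      obtain ⟨h₁, -, h₂, -⟩ := nextModulus_spec O (a := a) hm hmB
      have h₃ := nextModulus_le O a B m
      generalize nextModulus O a B m = m' at h₁ h₂ h₃
      obtain ⟨h₄, h₅, -, -⟩ := nextModulus_spec O (a := a) h₁ (h₃.trans_lt hmB)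
      have h₆ := nextModulus_le O a B m'
      generalize nextModulus O a B m' = m'' at h₄ h₅ h₆
      rcases eq_or_ne m 1 with rfl | hm1
      · left
        omega
      · right
        -- Either the first step already halves `m`, or it yields an even `m'`, which the second
        -- step halves.
        have h₇ : 2 * m'' ≤ m := by
          rcases h₂ with h | h | h
          · exact absurd h hm1
          · exact (h₅ h).trans h₃
          · omega
        rw [pow_succ, mul_assoc]
        exact (Nat.mul_le_mul_left _ h₇).trans (ih.resolve_left hm1)
  refine (key B).resolve_right fun h => ?_
  have := Nat.mul_le_mul_left (2 ^ B) (nextModulus_iterate_pos O (a := a) hn hB (2 * B))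
  omega

/-! ### Power towers -/

theorem le_tetration {a : ℕ} (ha : 2 ≤ a) (k : ℕ) : k ≤ tetration a k := by
  induction k with
  | zero => exact Nat.zero_le _
  | succ k ih => exact ih.trans_lt (Nat.lt_pow_self ha)

theorem tetration_one (k : ℕ) : tetration 1 k = 1 := by
  cases k <;> simp [tetration]

/-- Exponents below `B` are equal, and those from `B` on may be shifted by the period. For `a ≥ 2`
the powers in the second case are again at least `B`, so the relation passes up the tower. -/
theorem TruncModEq.pow {a B m n x y : ℕ} (ha : 1 ≤ a)
    (hm : ∀ x, B ≤ x → a ^ (x + m) ≡ a ^ x [MOD n]) (h : TruncModEq B m x y) :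
    TruncModEq B n (a ^ x) (a ^ y) := by
  rcases h with rfl | ⟨hx, hy, hxy⟩
  · exact .refl _ _ _
  rcases ha.eq_or_lt with rfl | ha
  · exact .inl (by simp)
  refine .inr ⟨hx.trans (Nat.lt_pow_self ha).le, hy.trans (Nat.lt_pow_self ha).le, ?_⟩
  have key : ∀ x q, B ≤ x → a ^ (x + m * q) ≡ a ^ x [MOD n] := by
    intro x q hx
    induction q with
    | zero => exact Nat.ModEq.refl _
    | succ q ih =>
      rw [mul_add, mul_one, ← add_assoc]
      exact (hm _ (hx.trans (Nat.le_add_right _ _))).trans ih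
  rcases le_total x y with hle | hle
  · obtain ⟨q, hq⟩ := (Nat.modEq_iff_dvd' hle).1 hxy
    have := key x q hx
    rw [← hq, Nat.add_sub_of_le hle] at this
    exact this.symm
  · obtain ⟨q, hq⟩ := (Nat.modEq_iff_dvd' hle).1 hxy.symm
    have := key y q hy
    rwa [← hq, Nat.add_sub_of_le hle] at this

/-- Towers of height at least `3 * B` are congruent modulo `N < 2 ^ B`. -/
theorem tetration_modEq_of_le (O : Subtype discreteLogarithm.IsOracle) {a B N k : ℕ} (ha : 1 ≤ a)
    (hN : 0 < N) (hB : N < 2 ^ B) (hk : 3 * B ≤ k) :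
    tetration a (3 * B) ≡ tetration a k [MOD N] := by
  -- The comparison starts at height `B`, where the modulus is `1` and, unless `a = 1`, both towers
  -- are at least `B`; it then climbs `2 * B` levels back to the modulus `N`.
  have key : ∀ i ≤ 2 * B, TruncModEq B ((nextModulus O a B)^[2 * B - i] N)
      (tetration a (B + i)) (tetration a (k - 2 * B + i)) := by
    intro i
    induction i with
    | zero =>
      intro _
      rcases ha.eq_or_lt with rfl | ha
      · exact .inl (by simp [tetration_one])
      · rw [Nat.sub_zero, nextModulus_iterate_eq_one O hN hB]
        exact .inr ⟨le_tetration ha B, (show B ≤ k - 2 * B by omega).trans (le_tetration ha _),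
          Nat.modEq_one⟩
    | succ i ih =>
      intro hi
      have h := ih (by omega)
      rw [show 2 * B - i = 2 * B - (i + 1) + 1 by omega, Function.iterate_succ_apply'] at h
      exact h.pow ha (nextModulus_spec O (nextModulus_iterate_pos O hN hB _)
        ((iterate_le_of_le (nextModulus_le O a B) _ N).trans_lt hB)).2.2.2
  have := (key (2 * B) le_rfl).modEq
  rwa [Nat.sub_self, show B + 2 * B = 3 * B by ring, show k - 2 * B + 2 * B = k by omega] at this

/-- The truncated residues of the towers of heights `0, …, K` over `a`, with respect to moduli
that end with `N`. -/
def towerResidue (O : Subtype discreteLogarithm.IsOracle) (a N K : ℕ) : ℕ → ℕ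
  | 0 => 1
  | j + 1 => truncMod N.size ((nextModulus O a N.size)^[K - 1 - j] N - 1)
      (a ^ towerResidue O a N K j)

theorem towerResidue_truncModEq (O : Subtype discreteLogarithm.IsOracle) {a N K : ℕ} (ha : 1 ≤ a)
    (hN : 0 < N) (j : ℕ) (hj : j ≤ K) :
    TruncModEq N.size ((nextModulus O a N.size)^[K - j] N) (towerResidue O a N K j)
      (tetration a j) := by
  have hB := Nat.lt_size_self N
  induction j with
  | zero => exact .refl _ _ _
  | succ j ih =>
    have h := ih (by omega)
    rw [show K - j = K - 1 - j + 1 by omega, Function.iterate_succ_apply'] at h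
    rw [show K - (j + 1) = K - 1 - j by omega, towerResidue, tetration]
    have hpos := nextModulus_iterate_pos O (a := a) hN hB (K - 1 - j)
    have ht := truncMod_truncModEq N.size ((nextModulus O a N.size)^[K - 1 - j] N - 1)
      (a ^ towerResidue O a N K j)
    rw [Nat.sub_add_cancel hpos] at ht
    exact ht.trans (h.pow ha (nextModulus_spec O hpos
      ((iterate_le_of_le (nextModulus_le O a _) _ N).trans_lt hB)).2.2.2)

theorem towerResidue_mod_eq (O : Subtype discreteLogarithm.IsOracle) {a k N : ℕ} (ha : 1 ≤ a)
    (hN : 0 < N) :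
    towerResidue O a N (min k (3 * N.size)) (min k (3 * N.size)) % N = tetration a k % N := by
  have h := (towerResidue_truncModEq O ha hN (min k (3 * N.size)) le_rfl).modEq
  rw [Nat.sub_self] at h
  refine h.trans ?_
  rcases le_total k (3 * N.size) with hk | hk
  · rw [min_eq_left hk]
  · rw [min_eq_right hk]
    exact tetration_modEq_of_le O ha hN (Nat.lt_size_self N) hk

/-! ### The reduction -/

section Reduction

variable {n : ℕ} {f g h : OracleFunction discreteLogarithm n}

theorem PolyTime.orderMultiple (hf : PolyTime f) (hg : PolyTime g) :
    PolyTime fun O x => orderMultiple O (f O x) (g O x) := by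
  -- The guard is nonzero exactly when the modulus is positive and prime to the base: a gcd of `0`
  -- also passes the inner test, but then the returned modulus is `0`.
  have hc := ((hg.gcd hf).sub (.const 1)).ite_eq_zero hf (.const 0)
  have hq := PolyTime.query (Q := discreteLogarithm) (g := ![f, fun O x => g O x % f O x,
      fun O x => _root_.truncMod 0 (f O x - 1) (g O x ^ f O x)])
    (fun x y _ hy => (Nat.size_le_size hy.1.le).trans (size_le_inputLength x 0)) hc
    (by
      intro i
      fin_cases i
      exacts [hf, hg.mod hf, (PolyTime.const 0).truncMod_pow (hf.sub (.const 1)) hg hf])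
  have harg : ∀ O x, (if Nat.gcd (g O x) (f O x) - 1 = 0 then f O x else 0) ≠ 0 →
      (fun i => (![f, fun O x => g O x % f O x,
        fun O x => _root_.truncMod 0 (f O x - 1) (g O x ^ f O x)] : Fin 3 → OracleFunction _ n) i O x) =
        ![f O x, g O x % f O x, g O x ^ f O x % f O x] ∧ 0 < f O x ∧ (g O x).Coprime (f O x) := by
    intro O x h0
    have hpos : 0 < f O x := by
      by_contra h1
      simp [show f O x = 0 by omega] at h0
    refine ⟨?_, hpos, ?_⟩
    · funext i
      fin_cases i
      exacts [rfl, rfl, truncMod_zero_pred hpos _]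
    · have := Nat.gcd_pos_of_pos_right (g O x) hpos
      have h1 : Nat.gcd (g O x) (f O x) - 1 = 0 := by
        by_contra h1
        exact h0 (if_neg h1)
      exact show Nat.gcd _ _ = 1 by omega
  refine (hf.sub (hq fun O x h0 => ?_)).of_eq fun O x => ?_
  · obtain ⟨e, hpos, hcop⟩ := harg O x h0
    rw [e]
    exact isInstance_discreteLogarithm hpos hcop
  · rw [_root_.orderMultiple]
    congr 1
    exact if_ctx_congr Iff.rfl (fun h0 => congrArg O.1 (harg O x h0).1) fun _ => rfl

theorem PolyTime.shortOrderMultiple (hf : PolyTime f) (hg : PolyTime g) :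
    PolyTime fun O x => shortOrderMultiple O (f O x) (g O x) :=
  ((hf.orderMultiple hg).mod (.const 2)).ite_eq_zero (hf.orderMultiple hg)
    (((hf.orderMultiple ((hf.sub (.const 1)).mul hg)).add (.const 1)).div (.const 2))

theorem PolyTime.powGcd (hf : PolyTime f) (hg : PolyTime g) (hh : PolyTime h) :
    PolyTime fun O x => powGcd (f O x) (g O x) (h O x) :=
  ((PolyTime.const 0).truncMod_pow (hh.sub (.const 1)) hf hg).gcd hh

theorem PolyTime.nextModulus (hf : PolyTime f) (hg : PolyTime g) (hh : PolyTime h) :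
    PolyTime fun O x => nextModulus O (f O x) (g O x) (h O x) := by
  have hd := (PolyTime.const 2).powGcd hg hh
  have hl := hh.div hd
  exact hh.min (((hd.add (.const 1)).div (.const 2)).mul
    ((hl.div (hf.powGcd hg hl)).shortOrderMultiple hf))

theorem PolyTime.towerResidue : PolyTime (Q := discreteLogarithm) (n := 3) fun O x =>
    towerResidue O (x 0) (x 2) (Min.min (x 1) (3 * (x 2).size))
      (Min.min (x 1) (3 * (x 2).size)) := by
  have u : ∀ i : Fin 7, PolyTime (Q := discreteLogarithm) fun _ x => x i := PolyTime.var
  have w : ∀ i : Fin 5, PolyTime (Q := discreteLogarithm) fun _ x => x i := PolyTime.var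
  have v : ∀ i : Fin 3, PolyTime (Q := discreteLogarithm) fun _ x => x i := PolyTime.var
  -- The moduli are needed in reverse order, so each is recomputed from `N`. The arguments are the
  -- index `j`, the previous residue, `a`, `k` and `N`.
  have hchain := PolyTime.natRec
    (h := fun O x i => (_root_.nextModulus O (x 2) (x 4).size)^[i] (x 4))
    ((((w 3).min ((PolyTime.const 3).mul (w 4).size)).sub (.const 1)).sub (w 0))
    (((PolyBounded.const 3).mul (w 4).polyBounded_size).mono fun O x => by omega) (w 4)
    ((u 4).nextModulus (u 6).size (u 1)) (fun O x => rfl)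
    (fun O x j _ => Function.iterate_succ_apply' _ _ _) (w 4).polyBounded_size
    (fun O x j _ => Nat.size_le_size (iterate_le_of_le (nextModulus_le _ _ _) _ _))
  exact PolyTime.natRec
    (h := fun O x j => _root_.towerResidue O (x 0) (x 2) (Min.min (x 1) (3 * (x 2).size)) j)
    ((v 1).min ((PolyTime.const 3).mul (v 2).size))
    (((PolyBounded.const 3).mul (v 2).polyBounded_size).mono fun O x => by omega) (.const 1)
    ((w 4).size.truncMod_pow (hchain.sub (.const 1)) (w 2) (w 1)) (fun O x => rfl)
    (fun O x j _ => rfl) (((v 2).size.add (v 2)).add (.const 1)).polyBounded_size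
    (fun O x j _ => by
      refine Nat.size_le_size ?_
      cases j with
      | zero => exact Nat.le_add_left _ _
      | succ j =>
        have := iterate_le_of_le (nextModulus_le O (x 0) (x 2).size)
          (Min.min (x 1) (3 * (x 2).size) - 1 - j) (x 2)
        refine (truncMod_le _ _ _).trans ?_
        omega)

end Reduction

theorem mainTheorem3 : modularTetration.PolyTimeReducible discreteLogarithm := by
  refine (PolyTime.towerResidue.mod (PolyTime.var 2)).reducible ?_
  rintro O x ⟨ha, hN⟩
  exact towerResidue_mod_eq O ha hN
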